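/- Let $X=\{\alpha\in\{0,1\}^{\mathbb N} : \alpha \text{ has infinitely many } 0\text{s and infinitely many } 1\text{s}\}$ with the topology induced by the product topology, and let $\mathbb Z$ act on $X$ by the iterates of the odometer $T$ (addition of $1$ with carry to the right, $1^k0\beta\mapsto 0^k1\beta$). Let $Y$ denote a $\mathbb Z$-space. A set $A\subseteq Y$ is *weakly wandering* if there is an infinite $H\subseteq\mathbb Z$ such that the sets $h\cdot A$, $h\in H$, are pairwise disjoint; it is *locally weakly wandering* if $A\cap(\mathbb Z\cdot x)$ is weakly wandering for every $x\in Y$. A *complete section* of an invariant set $C$ is a subset of $C$ that meets every orbit contained in $C$. A partition of $Y$ is *countably generated* by sets in a class $\Gamma$ if there are $B_0,B_1,\dots\in\Gamma$ such that $x,y\in Y$ lie in the same piece if and only if $x\in B_n\Leftrightarrow y\in B_n$ for all $n$. A Polish $\mathbb Z$-space (a Polish space on which $\mathbb Z$ acts by homeomorphisms) is *generically ergodic* if every invariant Borel set is meager or comeager. **Corollary.** There is an invariant dense $G_\delta$ set $Y\subseteq X$ which, with the subspace topology and the restricted action, is a generically ergodic Polish $\mathbb Z$-space with the following properties: (i)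 there is no invariant Borel probability measure on $Y$; (ii) there is no non-meager Baire measurable locally weakly wandering subset of $Y$; (iii) there is no partition of $Y$, countably generated by Baire measurable sets, into invariant sets each of which admits a Baire measurable weakly wandering complete section. In particular, $Y$ admits no invariant Borel probability measure, and there is no partition of $Y$, countably generated by Borel sets, into invariant sets each of which admits a Borel weakly wandering complete section; this answers a question of Eigen, Hajian and Nadkarni negatively. -/

import Mathlib

open Set MeasureTheory
open scoped Pointwise

section ZSpaces

variable {X : Type*} [AddAction ℤ X]

/-- A set is invariant if it is closed under the action of `ℤ`. -/
def IsInvariantSet (A : Set X) : Prop :=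
  ∀ n : ℤ, ∀ x ∈ A, n +ᵥ x ∈ A

/-- `A` is weakly wandering if its translates by the elements of some infinite `H ⊆ ℤ` are
pairwise disjoint. -/
def IsWeaklyWandering (A : Set X) : Prop :=
  ∃ H : Set ℤ, H.Infinite ∧ H.PairwiseDisjoint (fun n : ℤ => n +ᵥ A)

/-- `A` is locally weakly wandering if its trace on every orbit is weakly wandering. -/
def IsLocallyWeaklyWandering (A : Set X) : Prop :=
  ∀ x : X, IsWeaklyWandering (A ∩ AddAction.orbit ℤ x)

/-- `W` is a complete section of `C` if `W ⊆ C` and `W` meets the orbit of every point of `C`. -/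
def IsCompleteSectionOf (W C : Set X) : Prop :=
  W ⊆ C ∧ ∀ x ∈ C, (W ∩ AddAction.orbit ℤ x).Nonempty

variable (X) in
/-- The action is generically ergodic: every invariant Borel set is meager or comeager. -/
def IsGenericallyErgodic [TopologicalSpace X] : Prop :=
  ∀ A : Set X, MeasurableSet[borel X] A → IsInvariantSet A → IsMeagre A ∨ IsMeagre Aᶜ

variable (X) in
/-- There is an invariant Borel probability measure on `X`. -/
def HasInvariantBorelProbabilityMeasure [TopologicalSpace X] : Prop :=
  ∃ (_ : MeasurableSpace X) (_ : BorelSpace X) (μ : Measure X),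
    IsProbabilityMeasure μ ∧ VAddInvariantMeasure ℤ X μ

end ZSpaces

/-- `P` is a partition of `X` generated by countably many sets from the class `Γ`: the pieces are
the classes of the relation of not being separated by a sequence of sets in `Γ`. -/
def IsCountablyGeneratedPartition {X : Type*} (Γ : Set X → Prop) (P : Set (Set X)) : Prop :=
  Setoid.IsPartition P ∧ ∃ B : ℕ → Set X, (∀ n, Γ (B n)) ∧
    ∀ x y : X, (∃ C ∈ P, x ∈ C ∧ y ∈ C) ↔ ∀ n, (x ∈ B n ↔ y ∈ B n)

/-- There is a partition of `X`, countably generated by sets in `Γ`, into invariant sets each of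
which has a weakly wandering complete section in `Γ`. -/
def HasWeaklyWanderingPartition {X : Type*} [AddAction ℤ X] (Γ : Set X → Prop) : Prop :=
  ∃ P : Set (Set X), IsCountablyGeneratedPartition Γ P ∧
    ∀ C ∈ P, IsInvariantSet C ∧
      ∃ W : Set X, Γ W ∧ IsWeaklyWandering W ∧ IsCompleteSectionOf W C

section Odometer

/-- Adding one with carry to the right: `1ᵏ0β ↦ 0ᵏ1β`. -/
def carrySucc (α : ℕ → Bool) : ℕ → Bool :=
  fun n => if ∀ m < n, α m = true then !(α n) else α n

/-- Subtracting one with borrow: `0ᵏ1β ↦ 1ᵏ0β`. -/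
def carryPred (α : ℕ → Bool) : ℕ → Bool :=
  fun n => if ∀ m < n, α m = false then !(α n) else α n

theorem carrySucc_eq_false_iff (α : ℕ → Bool) (n : ℕ) :
    (∀ m < n, carrySucc α m = false) ↔ ∀ m < n, α m = true := by
  induction n with
  | zero => simp
  | succ n ih =>
    rw [Nat.forall_lt_succ_right, Nat.forall_lt_succ_right, ih]
    refine and_congr_right fun h => ?_
    simp only [carrySucc, if_pos h]
    simp

theorem carryPred_eq_true_iff (α : ℕ → Bool) (n : ℕ) :
    (∀ m < n, carryPred α m = true) ↔ ∀ m < n, α m = false := by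
  induction n with
  | zero => simp
  | succ n ih =>
    rw [Nat.forall_lt_succ_right, Nat.forall_lt_succ_right, ih]
    refine and_congr_right fun h => ?_
    simp only [carryPred, if_pos h]
    simp

theorem carryPred_carrySucc (α : ℕ → Bool) : carryPred (carrySucc α) = α := by
  funext n
  rw [carryPred]
  simp only [carrySucc_eq_false_iff]
  by_cases h : ∀ m < n, α m = true
  · rw [if_pos h, carrySucc, if_pos h, Bool.not_not]
  · rw [if_neg h, carrySucc, if_neg h]

theorem carrySucc_carryPred (α : ℕ → Bool) : carrySucc (carryPred α) = α := by
  funext n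
  rw [carrySucc]
  simp only [carryPred_eq_true_iff]
  by_cases h : ∀ m < n, α m = false
  · rw [if_pos h, carryPred, if_pos h, Bool.not_not]
  · rw [if_neg h, carryPred, if_neg h]

/-- The space of binary sequences with infinitely many `0`s and infinitely many `1`s, with the
topology induced by the product topology. -/
abbrev OdometerSpace : Type :=
  {α : ℕ → Bool // {n | α n = false}.Infinite ∧ {n | α n = true}.Infinite}

theorem infinite_of_eq_above {α β : ℕ → Bool} {b : Bool} (k : ℕ) (h : ∀ n, k < n → β n = α n)
    (hα : {n | α n = b}.Infinite) : {n | β n = b}.Infinite := by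
  refine Set.infinite_of_forall_exists_gt fun a => ?_
  obtain ⟨n, hn, hlt⟩ := hα.exists_gt (max a k)
  exact ⟨n, (h n ((le_max_right a k).trans_lt hlt)).trans hn, (le_max_left a k).trans_lt hlt⟩

theorem carrySucc_mem (x : OdometerSpace) :
    {n | carrySucc x.1 n = false}.Infinite ∧ {n | carrySucc x.1 n = true}.Infinite := by
  obtain ⟨k, hk⟩ := x.2.1.nonempty
  have h : ∀ n, k < n → carrySucc x.1 n = x.1 n := fun n hn =>
    if_neg fun H => by
      have h1 := H k hn
      rw [show x.1 k = false from hk] at h1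
      exact Bool.false_ne_true h1
  exact ⟨infinite_of_eq_above k h x.2.1, infinite_of_eq_above k h x.2.2⟩

theorem carryPred_mem (x : OdometerSpace) :
    {n | carryPred x.1 n = false}.Infinite ∧ {n | carryPred x.1 n = true}.Infinite := by
  obtain ⟨k, hk⟩ := x.2.2.nonempty
  have h : ∀ n, k < n → carryPred x.1 n = x.1 n := fun n hn =>
    if_neg fun H => by
      have h1 := H k hn
      rw [show x.1 k = true from hk] at h1
      exact Bool.false_ne_true h1.symm
  exact ⟨infinite_of_eq_above k h x.2.1, infinite_of_eq_above k h x.2.2⟩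

/-- The odometer transformation. -/
def odometer : Equiv.Perm OdometerSpace where
  toFun x := ⟨carrySucc x.1, carrySucc_mem x⟩
  invFun x := ⟨carryPred x.1, carryPred_mem x⟩
  left_inv x := Subtype.ext (carryPred_carrySucc x.1)
  right_inv x := Subtype.ext (carrySucc_carryPred x.1)

/-- The odometer space as a `ℤ`-space: `n` acts as the `n`-th iterate of the odometer. -/
instance odometerAddAction : AddAction ℤ OdometerSpace where
  vadd n x := (odometer ^ n) x
  zero_vadd _ := rfl
  add_vadd m n x := by
    change (odometer ^ (m + n)) x = (odometer ^ m) ((odometer ^ n) x)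
    rw [zpow_add, Equiv.Perm.mul_apply]

end Odometer

/-! The space `Y` is the largest invariant subset of the dense open set of sequences that vanish on
`[n, 2n)` for some `n ≥ 2`; being a countable intersection of dense open sets, it is a dense Gδ.

Acting by `m` adds `m` modulo `2 ^ k` to the number formed by the first `k` digits
(`binaryValue_vadd`). Hence `zeroBlock n` has `2 ^ n` disjoint translates, an invariant probability
measure gives it mass at most `2⁻¹ ^ n`, and the blocks covering `Y` have total mass at most 1/2.

Category does not see this smallness. A non-meager Baire measurable set is comeager in some cylinder
preserved by `2 ^ k ℤ`; any infinite `H` has two elements congruent modulo `2 ^ k`, and the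
corresponding translates meet on a generic orbit. Since orbits are dense, invariant sets obey a
zero-one law. It makes one piece of a countably generated partition comeager, and a complete section
of that piece is non-meager. -/

theorem IsGδ.polishSpace {X : Type*} [TopologicalSpace X] [PolishSpace X] {s : Set X}
    (hs : IsGδ s) : PolishSpace s := by
  obtain ⟨U, hU, rfl⟩ := isGδ_iff_eq_iInter_nat.1 hs
  have hp : ∀ n, PolishSpace (U n) := fun n => (hU n).polishSpace
  -- The diagonal map is a closed embedding into a product of Polish spaces: its range is cut out by
  -- equality of all coordinates with coordinate 0.
  let f : (⋂ n, U n : Set X) → ∀ n, U n := fun x n => ⟨x.1, mem_iInter.1 x.2 n⟩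
  have hf : Continuous f := continuous_pi fun n => continuous_subtype_val.subtype_mk _
  have hind : Topology.IsInducing f := by
    have hg : Continuous fun y : ∀ n, U n => ((y 0 : U 0) : X) :=
      continuous_subtype_val.comp (continuous_apply (A := fun n => U n) 0)
    refine Topology.IsInducing.of_comp hf hg ?_
    exact Topology.IsInducing.subtypeVal
  have hrange : range f = ⋂ n, {y : ∀ n, U n | (y n : X) = y 0} := by
    ext y
    simp only [mem_range, mem_iInter, mem_ofPred_eq]
    constructor
    · rintro ⟨x, rfl⟩ n
      rfl
    · intro h
      refine ⟨⟨(y 0 : X), mem_iInter.2 fun n => h n ▸ (y n).2⟩, ?_⟩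
      funext n
      exact Subtype.ext (h n).symm
  have hclosed : IsClosed (range f) := by
    rw [hrange]
    exact isClosed_iInter fun n => isClosed_eq
      (continuous_subtype_val.comp (continuous_apply (A := fun n => U n) n))
      (continuous_subtype_val.comp (continuous_apply (A := fun n => U n) 0))
  have hinj : Function.Injective f := fun x y h =>
    Subtype.ext (congrArg (fun z : ∀ n, U n => (z 0 : X)) h)
  exact Topology.IsClosedEmbedding.polishSpace ⟨⟨hind, hinj⟩, hclosed⟩

/-! ### Zero-one law and locally weakly wandering sets -/

section Category

variable {X : Type*} [TopologicalSpace X]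

theorem BaireMeasurableSet.exists_isOpen_isMeagre_diff {A : Set X} (hA : BaireMeasurableSet A)
    (hn : ¬ IsMeagre A) : ∃ U : Set X, IsOpen U ∧ U.Nonempty ∧ IsMeagre (U \ A) := by
  obtain ⟨U, hU, hAU⟩ := hA.residualEq_isOpen
  rw [Filter.eventuallyEq_set] at hAU
  refine ⟨U, hU, ?_, ?_⟩
  · by_contra h
    rw [not_nonempty_iff_eq_empty] at h
    subst h
    refine hn ?_
    filter_upwards [hAU] with x hx using fun h => hx.1 h
  · filter_upwards [hAU] with x hx using fun h => h.2 (hx.2 h.1)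

variable [AddAction ℤ X] [ContinuousConstVAdd ℤ X]

theorem IsMeagre.preimage_vadd {M : Set X} (hM : IsMeagre M) (n : ℤ) :
    IsMeagre {x | n +ᵥ x ∈ M} :=
  hM.preimage_of_isOpenMap (Homeomorph.vadd n).continuous (Homeomorph.vadd n).isOpenMap

theorem IsMeagre.saturation {M : Set X} (hM : IsMeagre M) :
    IsMeagre {x | ∃ n : ℤ, n +ᵥ x ∈ M} := by
  rw [ofPred_exists]
  exact isMeagre_iUnion fun n => hM.preimage_vadd n

/-- If `A` is comeager in an open `U`, every orbit enters `U` by minimality; the orbit of a point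
outside `A` then meets the meager set `U \ A`. -/
theorem IsInvariantSet.isMeagre_or_isMeagre_compl [AddAction.IsMinimal ℤ X] {A : Set X}
    (hA : IsInvariantSet A) (hm : BaireMeasurableSet A) : IsMeagre A ∨ IsMeagre Aᶜ := by
  by_contra! h
  obtain ⟨U, hU, hne, hUA⟩ := hm.exists_isOpen_isMeagre_diff h.1
  refine h.2 (hUA.saturation.mono fun x hx => ?_)
  obtain ⟨n, hn⟩ := hU.exists_vadd_mem ℤ x hne
  refine ⟨n, hn, fun hnA => hx ?_⟩
  simpa using hA (-n) _ hnA

variable (X) in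
/-- Every point has arbitrarily small open neighbourhoods invariant under a nontrivial subgroup
of `ℤ`. -/
def HasPeriodicBasis : Prop :=
  ∀ x : X, ∀ U ∈ nhds x, ∃ V ⊆ U, IsOpen V ∧ x ∈ V ∧
    ∃ k : ℤ, 0 < k ∧ ∀ j : ℤ, ∀ y ∈ V, (k * j) +ᵥ y ∈ V

theorem HasPeriodicBasis.not_isLocallyWeaklyWandering [BaireSpace X] [Nonempty X]
    [AddAction.IsMinimal ℤ X] (hX : HasPeriodicBasis X) {A : Set X} (hA : BaireMeasurableSet A)
    (hn : ¬ IsMeagre A) : ¬ IsLocallyWeaklyWandering A := by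
  intro hw
  obtain ⟨U, hU, ⟨u, hu⟩, hUA⟩ := hA.exists_isOpen_isMeagre_diff hn
  obtain ⟨V, hVU, hV, huV, k, hk, hper⟩ := hX u U (hU.mem_nhds hu)
  -- For a generic `x`, the whole trace of its orbit on `V` lies in `A`.
  obtain ⟨x, hx⟩ : ({x | ∃ n : ℤ, n +ᵥ x ∈ U \ A}ᶜ : Set X).Nonempty :=
    (dense_of_mem_residual hUA.saturation).nonempty
  have hmem : ∀ n : ℤ, n +ᵥ x ∈ V → n +ᵥ x ∈ A := fun n hnV => by
    by_contra hnA
    exact hx ⟨n, hVU hnV, hnA⟩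
  obtain ⟨H, hH, hdis⟩ := hw x
  -- Pigeonhole on residues: `a` and `b` differ by a multiple of `k`, and that multiple moves points
  -- of `V` within `V`.
  obtain ⟨a, ha, b, hb, hab, hmod⟩ := hH.exists_ne_map_eq_of_mapsTo
    (f := fun n : ℤ => n % k) (t := Ico 0 k)
    (fun n _ => ⟨Int.emod_nonneg _ hk.ne', Int.emod_lt_of_pos _ hk⟩) (finite_Ico 0 k)
  obtain ⟨j, hj⟩ : k ∣ a - b := Int.ModEq.dvd (Eq.symm hmod)
  obtain ⟨n, hnV⟩ := hV.exists_vadd_mem ℤ x ⟨u, huV⟩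
  have hnV' := hper j _ hnV
  rw [vadd_vadd] at hnV'
  refine disjoint_left.1 (hdis ha hb hab)
    (vadd_mem_vadd_set (a := a) (show n +ᵥ x ∈ A ∩ _ from ⟨hmem _ hnV, n, rfl⟩)) ?_
  have : a +ᵥ (n +ᵥ x) = b +ᵥ ((k * j + n) +ᵥ x) := by
    rw [vadd_vadd, vadd_vadd, ← hj]
    congr 1
    ring
  rw [this]
  exact vadd_mem_vadd_set ⟨hmem _ hnV', _, rfl⟩

end Category

section WeaklyWandering

variable {X : Type*} [AddAction ℤ X]

theorem IsWeaklyWandering.mono {A B : Set X} (hB : IsWeaklyWandering B) (h : A ⊆ B) :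
    IsWeaklyWandering A := by
  obtain ⟨H, hH, hdis⟩ := hB
  exact ⟨H, hH, hdis.mono_on fun n _ => vadd_set_mono h⟩

theorem IsWeaklyWandering.isLocallyWeaklyWandering {A : Set X} (hA : IsWeaklyWandering A) :
    IsLocallyWeaklyWandering A :=
  fun _ => hA.mono inter_subset_left

end WeaklyWandering

/-! ### Countably generated partitions -/

section Partition

variable {X : Type*} [TopologicalSpace X] [AddAction ℤ X] [ContinuousConstVAdd ℤ X]

/-- Each generating set is a union of pieces, hence invariant, hence meager or comeager. So generic
points share one membership pattern, which means one piece. -/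
theorem exists_mem_partition_isMeagre_compl [BaireSpace X] [Nonempty X]
    [AddAction.IsMinimal ℤ X] {Γ : Set X → Prop} (hΓ : ∀ A, Γ A → BaireMeasurableSet A)
    {P : Set (Set X)} (hP : IsCountablyGeneratedPartition Γ P)
    (hinv : ∀ C ∈ P, IsInvariantSet C) : ∃ C ∈ P, IsMeagre Cᶜ := by
  obtain ⟨hpart, B, hB, hsep⟩ := hP
  have hcover : ∀ x : X, ∃ C ∈ P, x ∈ C := fun x => (hpart.2 x).exists
  have hBinv : ∀ n, IsInvariantSet (B n) := by
    intro n m x hx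
    obtain ⟨C, hC, hxC⟩ := hcover x
    exact ((hsep x (m +ᵥ x)).1 ⟨C, hC, hxC, hinv C hC m x hxC⟩ n).1 hx
  have hev : ∀ n, ∃ p : Prop, ∀ᶠ x in residual X, (x ∈ B n ↔ p) := by
    intro n
    rcases (hBinv n).isMeagre_or_isMeagre_compl (hΓ _ (hB n)) with h | h
    · exact ⟨False, by filter_upwards [h] with x hx using iff_false_intro hx⟩
    · exact ⟨True, by filter_upwards [h] with x hx using iff_true_intro (not_not.1 hx)⟩
  choose p hp using hev
  have hall : {x | ∀ n, x ∈ B n ↔ p n} ∈ residual X := eventually_countable_forall.2 hp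
  obtain ⟨x, hx⟩ := (dense_of_mem_residual hall).nonempty
  obtain ⟨C, hC, hxC⟩ := hcover x
  refine ⟨C, hC, ?_⟩
  rw [IsMeagre, compl_compl]
  filter_upwards [hall] with y hy
  obtain ⟨D, hD, hxD, hyD⟩ := (hsep x y).2 fun n => (hx n).trans (hy n).symm
  rwa [(hpart.2 x).unique ⟨hC, hxC⟩ ⟨hD, hxD⟩]

theorem HasPeriodicBasis.not_hasWeaklyWanderingPartition [BaireSpace X] [Nonempty X]
    [AddAction.IsMinimal ℤ X] (hX : HasPeriodicBasis X) {Γ : Set X → Prop}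
    (hΓ : ∀ A, Γ A → BaireMeasurableSet A) : ¬ HasWeaklyWanderingPartition Γ := by
  rintro ⟨P, hP, hpieces⟩
  obtain ⟨C, hC, hmeagre⟩ :=
    exists_mem_partition_isMeagre_compl hΓ hP fun C hC => (hpieces C hC).1
  obtain ⟨-, W, hW, hww, -, hsec⟩ := hpieces C hC
  refine hX.not_isLocallyWeaklyWandering (hΓ W hW) (fun hWm => ?_) hww.isLocallyWeaklyWandering
  have hsub : (univ : Set X) ⊆ {x | ∃ n : ℤ, n +ᵥ x ∈ W} ∪ Cᶜ := by
    intro x _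
    by_cases hx : x ∈ C
    · obtain ⟨_, hyW, n, rfl⟩ := hsec x hx
      exact Or.inl ⟨n, hyW⟩
    · exact Or.inr hx
  exact not_isMeagre_of_isOpen isOpen_univ univ_nonempty
    ((hWm.saturation.union hmeagre).mono hsub)

end Partition

/-! ### Binary arithmetic of the odometer -/

section BinaryValue

/-- The number with binary digits `α 0, …, α (k - 1)`, least significant digit first. -/
def binaryValue (k : ℕ) (α : ℕ → Bool) : ℕ :=
  ∑ i ∈ Finset.range k, (α i).toNat * 2 ^ i

theorem binaryValue_succ (k : ℕ) (α : ℕ → Bool) :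
    binaryValue (k + 1) α = binaryValue k α + (α k).toNat * 2 ^ k :=
  Finset.sum_range_succ _ _

theorem binaryValue_lt (k : ℕ) (α : ℕ → Bool) : binaryValue k α < 2 ^ k := by
  induction k with
  | zero => simp [binaryValue]
  | succ k ih =>
    rw [binaryValue_succ, pow_succ]
    cases α k <;> simp <;> omega

theorem eq_of_binaryValue_eq {k : ℕ} {α β : ℕ → Bool} (h : binaryValue k α = binaryValue k β) :
    ∀ i < k, α i = β i := by
  induction k with
  | zero => simp
  | succ k ih =>
    rw [binaryValue_succ, binaryValue_succ] at h
    have h1 := binaryValue_lt k α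
    have h2 := binaryValue_lt k β
    have hk : α k = β k := by
      revert h
      cases α k <;> cases β k <;> simp <;> omega
    rw [hk] at h
    exact Nat.forall_lt_succ_right.2 ⟨ih (Nat.add_right_cancel h), hk⟩

/-- The conditional term is the carry out of the first `k` digits. -/
theorem binaryValue_carrySucc (k : ℕ) (α : ℕ → Bool) :
    binaryValue k (carrySucc α) + (if ∀ m < k, α m = true then 2 ^ k else 0) =
      binaryValue k α + 1 := by
  induction k with
  | zero => simp [binaryValue]
  | succ k ih =>
    simp only [binaryValue_succ, Nat.forall_lt_succ_right, pow_succ]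
    rw [carrySucc]
    by_cases h : ∀ m < k, α m = true
    · rw [if_pos h] at ih
      rw [if_pos h]
      cases hk : α k
      · rw [if_neg fun h' => Bool.false_ne_true h'.2]
        simp
        omega
      · rw [if_pos ⟨h, rfl⟩]
        simp
        omega
    · rw [if_neg h] at ih
      rw [if_neg h, if_neg fun h' => h h'.1]
      omega

theorem binaryValue_carrySucc_modEq (k : ℕ) (α : ℕ → Bool) :
    (binaryValue k (carrySucc α) : ℤ) ≡ binaryValue k α + 1 [ZMOD 2 ^ k] := by
  have h := binaryValue_carrySucc k α
  rw [Int.modEq_iff_dvd]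
  refine ⟨if ∀ m < k, α m = true then 1 else 0, ?_⟩
  split_ifs at h ⊢ with hk <;> zify at h <;> linarith

end BinaryValue

/-! ### Continuity, minimality and periodic cylinders of the odometer -/

section OdometerDynamics

theorem OdometerSpace.one_vadd (x : OdometerSpace) : ((1 : ℤ) +ᵥ x).1 = carrySucc x.1 := by
  change ((odometer ^ (1 : ℤ)) x).1 = _
  rw [zpow_one]
  rfl

theorem OdometerSpace.neg_one_vadd (x : OdometerSpace) :
    ((-1 : ℤ) +ᵥ x).1 = carryPred x.1 := by
  change ((odometer ^ (-1 : ℤ)) x).1 = _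
  rw [zpow_neg_one]
  rfl

theorem binaryValue_vadd (k : ℕ) (n : ℤ) (x : OdometerSpace) :
    (binaryValue k (n +ᵥ x).1 : ℤ) ≡ n + binaryValue k x.1 [ZMOD 2 ^ k] := by
  have hstep : ∀ m : ℤ, (binaryValue k ((m + 1) +ᵥ x).1 : ℤ) ≡
      binaryValue k (m +ᵥ x).1 + 1 [ZMOD 2 ^ k] := fun m => by
    rw [add_comm m 1, add_vadd, OdometerSpace.one_vadd]
    exact binaryValue_carrySucc_modEq k _
  induction n using Int.induction_on with
  | zero => simp
  | succ i ih =>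
    refine (hstep i).trans ((ih.add_right 1).trans ?_)
    rw [add_right_comm]
  | pred i ih =>
    have h := hstep (-(i : ℤ) - 1)
    rw [sub_add_cancel] at h
    refine Int.ModEq.add_right_cancel' 1 (h.symm.trans (ih.trans ?_))
    rw [sub_add_eq_add_sub, sub_add_cancel]

theorem binaryValue_eq_of_modEq {k : ℕ} {α β : ℕ → Bool}
    (h : (binaryValue k α : ℤ) ≡ binaryValue k β [ZMOD 2 ^ k]) :
    binaryValue k α = binaryValue k β := by
  have h' : binaryValue k α ≡ binaryValue k β [MOD 2 ^ k] :=
    Int.natCast_modEq_iff.1 (by push_cast; exact h)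
  exact h'.eq_of_lt_of_lt (binaryValue_lt _ _) (binaryValue_lt _ _)

theorem exists_vadd_eq_below (x y : OdometerSpace) (k : ℕ) :
    ∃ n : ℤ, ∀ i < k, (n +ᵥ x).1 i = y.1 i := by
  refine ⟨binaryValue k y.1 - binaryValue k x.1,
    eq_of_binaryValue_eq (binaryValue_eq_of_modEq ((binaryValue_vadd k _ x).trans ?_))⟩
  rw [sub_add_cancel]

theorem two_pow_mul_vadd_eq_below (x : OdometerSpace) (k : ℕ) (j : ℤ) :
    ∀ i < k, ((2 ^ k * j) +ᵥ x).1 i = x.1 i := by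
  refine eq_of_binaryValue_eq (binaryValue_eq_of_modEq ((binaryValue_vadd k _ x).trans ?_))
  exact Int.modEq_iff_dvd.2 ⟨-j, by ring⟩

theorem isOpen_agree_below (x : OdometerSpace) (k : ℕ) :
    IsOpen {y : OdometerSpace | ∀ i < k, y.1 i = x.1 i} := by
  have : {y : OdometerSpace | ∀ i < k, y.1 i = x.1 i} =
      ⋂ i ∈ Iio k, (fun y : OdometerSpace => y.1 i) ⁻¹' {x.1 i} := by
    ext y
    simp
  rw [this]
  exact (finite_Iio k).isOpen_biInter fun i _ =>
    (isOpen_discrete _).preimage ((continuous_apply i).comp continuous_subtype_val)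

theorem exists_agree_below_subset {x : OdometerSpace} {U : Set OdometerSpace}
    (hU : U ∈ nhds x) : ∃ k, {y : OdometerSpace | ∀ i < k, y.1 i = x.1 i} ⊆ U := by
  obtain ⟨T, hT, hTU⟩ := mem_nhds_subtype _ _ _ |>.1 hU
  obtain ⟨T', hT'T, hopen, hx⟩ := mem_nhds_iff.1 hT
  obtain ⟨I, u, hu, hsub⟩ := isOpen_pi_iff.1 hopen x.1 hx
  refine ⟨I.sup id + 1, fun y hy => hTU (hT'T (hsub fun i hi => ?_))⟩
  rw [hy i (Nat.lt_succ_of_le (Finset.le_sup (f := id) hi))]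
  exact (hu i hi).2

theorem continuous_of_determined_below {f : OdometerSpace → OdometerSpace}
    (hf : ∀ x y : OdometerSpace, ∀ n, (∀ i < n + 1, y.1 i = x.1 i) → (f y).1 n = (f x).1 n) :
    Continuous f := by
  refine Continuous.subtype_mk (continuous_pi fun n => ?_) _
  refine continuous_iff_continuousAt.2 fun x => ?_
  refine continuousAt_const.congr (f := fun _ => (f x).1 n) ?_
  filter_upwards [(isOpen_agree_below x (n + 1)).mem_nhds fun _ _ => rfl] with y hy
  exact (hf x y n hy).symm

theorem continuous_odometer : Continuous odometer :=
  continuous_of_determined_below fun x y n h => by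
    change carrySucc y.1 n = carrySucc x.1 n
    have : (∀ m < n, y.1 m = true) ↔ ∀ m < n, x.1 m = true :=
      forall₂_congr fun m hm => by rw [h m (by omega)]
    simp only [carrySucc, this, h n (by omega)]

theorem continuous_odometer_symm : Continuous odometer.symm :=
  continuous_of_determined_below fun x y n h => by
    change carryPred y.1 n = carryPred x.1 n
    have : (∀ m < n, y.1 m = false) ↔ ∀ m < n, x.1 m = false :=
      forall₂_congr fun m hm => by rw [h m (by omega)]
    simp only [carryPred, this, h n (by omega)]

instance : ContinuousConstVAdd ℤ OdometerSpace where
  continuous_const_vadd n := by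
    induction n using Int.induction_on with
    | zero => simpa using continuous_id'
    | succ i ih =>
      have : (fun x : OdometerSpace => ((i : ℤ) + 1) +ᵥ x) = odometer ∘ fun x => (i : ℤ) +ᵥ x := by
        funext x
        rw [add_comm, add_vadd]
        exact Subtype.ext (OdometerSpace.one_vadd _)
      rw [this]
      exact continuous_odometer.comp ih
    | pred i ih =>
      have : (fun x : OdometerSpace => (-(i : ℤ) - 1) +ᵥ x) =
          odometer.symm ∘ fun x => -(i : ℤ) +ᵥ x := by
        funext x
        rw [sub_eq_add_neg, add_comm, add_vadd]
        exact Subtype.ext (OdometerSpace.neg_one_vadd _)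
      rw [this]
      exact continuous_odometer_symm.comp ih

instance : AddAction.IsMinimal ℤ OdometerSpace where
  dense_orbit x := by
    refine dense_iff_inter_open.2 fun U hU ⟨y, hy⟩ => ?_
    obtain ⟨k, hk⟩ := exists_agree_below_subset (hU.mem_nhds hy)
    obtain ⟨n, hn⟩ := exists_vadd_eq_below x y k
    exact ⟨n +ᵥ x, hk hn, n, rfl⟩

theorem hasPeriodicBasis_odometerSpace : HasPeriodicBasis OdometerSpace := by
  intro x U hU
  obtain ⟨k, hk⟩ := exists_agree_below_subset hU
  exact ⟨_, hk, isOpen_agree_below x k, fun _ _ => rfl, 2 ^ k, by positivity, fun j y hy i hi =>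
    (two_pow_mul_vadd_eq_below y k j i hi).trans (hy i hi)⟩

theorem isGδ_infinite_eq (b : Bool) : IsGδ {α : ℕ → Bool | {n | α n = b}.Infinite} := by
  have : {α : ℕ → Bool | {n | α n = b}.Infinite} =
      ⋂ m : ℕ, ⋃ n ∈ Ioi m, (fun α : ℕ → Bool => α n) ⁻¹' {b} := by
    ext α
    simp only [mem_ofPred_eq, mem_iInter, mem_iUnion, mem_preimage, mem_singleton_iff, mem_Ioi,
      exists_prop]
    constructor
    · intro h m
      obtain ⟨n, hn, hlt⟩ := h.exists_gt m
      exact ⟨n, hlt, hn⟩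
    · exact fun h => infinite_of_forall_exists_gt fun m =>
        let ⟨n, hlt, hn⟩ := h m
        ⟨n, hn, hlt⟩
  rw [this]
  exact IsGδ.iInter_of_isOpen fun m => isOpen_biUnion fun n _ =>
    (isOpen_discrete _).preimage (continuous_apply n)

instance : PolishSpace OdometerSpace :=
  have : PolishSpace Bool := inferInstance
  have : PolishSpace (ℕ → Bool) := inferInstance
  ((isGδ_infinite_eq false).inter (isGδ_infinite_eq true)).polishSpace

instance : Nonempty OdometerSpace := by
  refine ⟨⟨fun n => decide (Even n), ?_, ?_⟩⟩
  · exact infinite_of_forall_exists_gt fun m => ⟨2 * m + 1, by simp, by omega⟩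
  · exact infinite_of_forall_exists_gt fun m => ⟨2 * (m + 1), by simp, by omega⟩

end OdometerDynamics

/-! ### Invariant cores and restricted actions -/

section InvariantCore

variable {X : Type*} [AddAction ℤ X]

/-- The largest invariant subset of `D`. -/
def invariantCore (D : Set X) : SubAddAction ℤ X where
  carrier := {x | ∀ n : ℤ, n +ᵥ x ∈ D}
  vadd_mem' m x hx n := by
    rw [vadd_vadd]
    exact hx (n + m)

theorem invariantCore_subset (D : Set X) : (invariantCore D : Set X) ⊆ D := fun x hx => by
  simpa using hx 0

theorem coe_invariantCore (D : Set X) :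
    (invariantCore D : Set X) = ⋂ n : ℤ, (fun x => n +ᵥ x) ⁻¹' D := by
  ext x
  rw [mem_iInter]
  rfl

end InvariantCore

section SubActions

variable {X : Type*} [TopologicalSpace X] [AddAction ℤ X]

instance [ContinuousConstVAdd ℤ X] (Y : SubAddAction ℤ X) : ContinuousConstVAdd ℤ Y where
  continuous_const_vadd n :=
    ((continuous_const_vadd n).comp continuous_subtype_val).subtype_mk _

instance [AddAction.IsMinimal ℤ X] (Y : SubAddAction ℤ X) : AddAction.IsMinimal ℤ Y where
  dense_orbit x := by
    refine dense_iff_inter_open.2 ?_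
    rintro _ ⟨U, hU, rfl⟩ ⟨y, hy⟩
    obtain ⟨n, hn⟩ := hU.exists_vadd_mem ℤ x.1 ⟨y.1, hy⟩
    exact ⟨n +ᵥ x, hn, n, rfl⟩

theorem HasPeriodicBasis.subAddAction (hX : HasPeriodicBasis X) (Y : SubAddAction ℤ X) :
    HasPeriodicBasis Y := by
  intro x U hU
  obtain ⟨T, hT, hTU⟩ := (mem_nhds_subtype _ _ _).1 hU
  obtain ⟨V, hVT, hV, hxV, k, hk, hper⟩ := hX x.1 T hT
  exact ⟨Subtype.val ⁻¹' V, (preimage_mono hVT).trans hTU, hV.preimage continuous_subtype_val,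
    hxV, k, hk, fun j y hy => hper j y.1 hy⟩

variable [ContinuousConstVAdd ℤ X]

theorem isGδ_invariantCore {D : Set X} (hD : IsOpen D) : IsGδ (invariantCore D : Set X) := by
  rw [coe_invariantCore]
  exact IsGδ.iInter_of_isOpen fun n => hD.preimage (continuous_const_vadd n)

theorem dense_invariantCore [BaireSpace X] {D : Set X} (hD : IsOpen D) (hd : Dense D) :
    Dense (invariantCore D : Set X) := by
  rw [coe_invariantCore]
  exact dense_iInter_of_isOpen (fun n => hD.preimage (continuous_const_vadd n))
    fun n => hd.preimage (Homeomorph.vadd n).isOpenMap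

end SubActions

/-! ### Zero blocks and the absence of invariant measures -/

section ZeroBlocks

/-- The sequences that vanish on the interval `[n, 2n)`. -/
def zeroBlock (n : ℕ) : Set OdometerSpace :=
  {x | ∀ i ∈ Ico n (2 * n), x.1 i = false}

theorem isOpen_zeroBlock (n : ℕ) : IsOpen (zeroBlock n) := by
  have : zeroBlock n = ⋂ i ∈ Ico n (2 * n), (fun x : OdometerSpace => x.1 i) ⁻¹' {false} := by
    ext x
    simp [zeroBlock]
  rw [this]
  exact (finite_Ico _ _).isOpen_biInter fun i _ =>
    (isOpen_discrete _).preimage ((continuous_apply i).comp continuous_subtype_val)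

theorem binaryValue_of_mem_zeroBlock {n : ℕ} {x : OdometerSpace} (hx : x ∈ zeroBlock n) :
    binaryValue (2 * n) x.1 = binaryValue n x.1 := by
  rw [binaryValue, two_mul, Finset.sum_range_add, binaryValue, Nat.add_eq_left]
  refine Finset.sum_eq_zero fun i hi => ?_
  rw [hx (n + i) ⟨by omega, by have := Finset.mem_range.1 hi; omega⟩]
  simp

/-- Modulo `2 ^ (2 * n)`, points of the block have value below `2 ^ n`, so distinct multiples of `2
^ n` cannot bring one point into it twice. -/
theorem eq_of_vadd_mem_zeroBlock {n : ℕ} {i j : ℕ} (hi : i < 2 ^ n) (hj : j < 2 ^ n)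
    {x : OdometerSpace} (hxi : ((2 ^ n * i : ℕ) : ℤ) +ᵥ x ∈ zeroBlock n)
    (hxj : ((2 ^ n * j : ℕ) : ℤ) +ᵥ x ∈ zeroBlock n) : i = j := by
  have h1 := binaryValue_vadd (2 * n) (2 ^ n * i : ℕ) x
  have h2 := binaryValue_vadd (2 * n) (2 ^ n * j : ℕ) x
  rw [binaryValue_of_mem_zeroBlock hxi] at h1
  rw [binaryValue_of_mem_zeroBlock hxj] at h2
  set a := binaryValue n (((2 ^ n * i : ℕ) : ℤ) +ᵥ x).1
  set b := binaryValue n (((2 ^ n * j : ℕ) : ℤ) +ᵥ x).1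
  have ha : a < 2 ^ n := binaryValue_lt _ _
  have hb : b < 2 ^ n := binaryValue_lt _ _
  have h3 : ((a + 2 ^ n * j : ℕ) : ℤ) ≡ ((b + 2 ^ n * i : ℕ) : ℤ) [ZMOD ((2 ^ (2 * n) : ℕ) : ℤ)] := by
    push_cast at h1 h2 ⊢
    have h4 := (h1.add_right (2 ^ n * j)).trans ((h2.add_right (2 ^ n * i)).trans ?_ |>.symm)
    · exact h4
    · rw [show (2 ^ n * j + binaryValue (2 * n) x.1 + 2 ^ n * i : ℤ) =
        2 ^ n * i + binaryValue (2 * n) x.1 + 2 ^ n * j by ring]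
  have hlt : ∀ c d : ℕ, c < 2 ^ n → d < 2 ^ n → c + 2 ^ n * d < 2 ^ (2 * n) := by
    intro c d hc hd
    calc c + 2 ^ n * d < 2 ^ n * (d + 1) := by rw [mul_add_one]; omega
      _ ≤ 2 ^ n * 2 ^ n := Nat.mul_le_mul_left _ hd
      _ = 2 ^ (2 * n) := by rw [two_mul, pow_add]
  have h4 : a + 2 ^ n * j = b + 2 ^ n * i :=
    (Int.natCast_modEq_iff.1 h3).eq_of_lt_of_lt (hlt _ _ ha hj) (hlt _ _ hb hi)
  have h5 := congrArg (· / 2 ^ n) h4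
  simp only [Nat.add_mul_div_left _ _ (Nat.two_pow_pos n), Nat.div_eq_of_lt ha,
    Nat.div_eq_of_lt hb, zero_add] at h5
  exact h5.symm

theorem dense_iUnion_zeroBlock : Dense (⋃ n : ℕ, zeroBlock (n + 2)) := by
  refine dense_iff_inter_open.2 fun U hU ⟨x, hx⟩ => ?_
  obtain ⟨k, hk⟩ := exists_agree_below_subset (hU.mem_nhds hx)
  -- The new zeros start beyond digit `k`, so the sequence stays in the given cylinder.
  let β : ℕ → Bool := fun i => if i ∈ Ico (k + 2) (2 * (k + 2)) then false else x.1 i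
  have hβ : ∀ i, 2 * (k + 2) < i → β i = x.1 i := fun i hi =>
    if_neg fun h => by have := h.2; omega
  let y : OdometerSpace :=
    ⟨β, infinite_of_eq_above _ hβ x.2.1, infinite_of_eq_above _ hβ x.2.2⟩
  refine ⟨y, hk fun i hi => if_neg fun h => ?_, mem_iUnion.2 ⟨k, fun i hi => if_pos hi⟩⟩
  have := h.1
  omega

theorem measure_zeroBlock_le (Y : SubAddAction ℤ OdometerSpace) [MeasurableSpace Y] [BorelSpace Y]
    (μ : Measure Y) [IsProbabilityMeasure μ] [VAddInvariantMeasure ℤ Y μ] (n : ℕ) :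
    μ (Subtype.val ⁻¹' zeroBlock n) ≤ (2⁻¹ : ENNReal) ^ n := by
  set E : Set Y := Subtype.val ⁻¹' zeroBlock n
  have hE : MeasurableSet E :=
    ((isOpen_zeroBlock n).preimage continuous_subtype_val).measurableSet
  let F : ℕ → Set Y := fun i => (fun x => ((2 ^ n * i : ℕ) : ℤ) +ᵥ x) ⁻¹' E
  have hF : ∀ i, MeasurableSet (F i) := fun i =>
    (((isOpen_zeroBlock n).preimage continuous_subtype_val).preimage
      (continuous_const_vadd _)).measurableSet
  have hdis : (Finset.range (2 ^ n) : Set ℕ).PairwiseDisjoint F := by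
    intro i hi j hj hij
    refine disjoint_left.2 fun x hxi hxj => hij ?_
    exact eq_of_vadd_mem_zeroBlock (Finset.mem_range.1 hi) (Finset.mem_range.1 hj)
      (x := x.1) hxi hxj
  have hsum : (2 : ENNReal) ^ n * μ E ≤ 1 := by
    calc (2 : ENNReal) ^ n * μ E = ∑ i ∈ Finset.range (2 ^ n), μ (F i) := by
          rw [Finset.sum_congr rfl fun i _ => VAddInvariantMeasure.measure_preimage_vadd _ hE]
          simp
      _ = μ (⋃ i ∈ Finset.range (2 ^ n), F i) :=
          (measure_biUnion_finset hdis fun i _ => hF i).symm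
      _ ≤ 1 := prob_le_one
  rw [← ENNReal.inv_pow]
  exact ENNReal.le_inv_iff_mul_le.2 (by rwa [mul_comm])

theorem not_hasInvariantBorelProbabilityMeasure_of_subset {Y : SubAddAction ℤ OdometerSpace}
    (hY : (Y : Set OdometerSpace) ⊆ ⋃ n : ℕ, zeroBlock (n + 2)) :
    ¬ HasInvariantBorelProbabilityMeasure Y := by
  rintro ⟨_, _, μ, _, _⟩
  have hcover : (univ : Set Y) ⊆ ⋃ n : ℕ, Subtype.val ⁻¹' zeroBlock (n + 2) := fun x _ => by
    simpa using hY x.2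
  -- The index shift by 2 matters: blocks from 1 on would only give the bound 1, which is no
  -- contradiction.
  have h : (1 : ENNReal) ≤ 2⁻¹ := by
    calc (1 : ENNReal) = μ univ := measure_univ.symm
      _ ≤ ∑' n : ℕ, μ (Subtype.val ⁻¹' zeroBlock (n + 2)) :=
          (measure_mono hcover).trans (measure_iUnion_le _)
      _ ≤ ∑' n : ℕ, (2⁻¹ : ENNReal) ^ (n + 2) :=
          ENNReal.tsum_le_tsum fun n => measure_zeroBlock_le Y μ _
      _ = 2⁻¹ := by
          simp_rw [pow_add, ENNReal.tsum_mul_right, ENNReal.tsum_geometric, ENNReal.one_sub_inv_two,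
            inv_inv, pow_two, ← mul_assoc]
          rw [ENNReal.mul_inv_cancel (by simp) (by simp), one_mul]
  exact absurd h (not_le.2 ENNReal.one_half_lt_one)

end ZeroBlocks

theorem mainTheorem7 :
    ∃ Y : SubAddAction ℤ OdometerSpace,
      -- `Y` is an invariant dense `G_δ` subset of the odometer space
      IsGδ (Y : Set OdometerSpace) ∧ Dense (Y : Set OdometerSpace) ∧
      -- `Y` is a generically ergodic Polish `ℤ`-space
      PolishSpace Y ∧ ContinuousConstVAdd ℤ Y ∧ IsGenericallyErgodic Y ∧
      -- there is no invariant Borel probability measure on `Y`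
      ¬ HasInvariantBorelProbabilityMeasure Y ∧
      -- `Y` has no non-meager Baire measurable locally weakly wandering subset
      (¬ ∃ A : Set Y, BaireMeasurableSet A ∧ ¬ IsMeagre A ∧ IsLocallyWeaklyWandering A) ∧
      -- `Y` has no countably generated Baire measurable partition into invariant sets with
      -- Baire measurable weakly wandering complete sections
      ¬ HasWeaklyWanderingPartition (X := Y) (fun A => BaireMeasurableSet A) ∧
      -- in particular there is no such partition in the Borel sense
      ¬ HasWeaklyWanderingPartition (X := Y) (fun A => MeasurableSet[borel Y] A) := by
  set D : Set OdometerSpace := ⋃ n : ℕ, zeroBlock (n + 2)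
  have hD : IsOpen D := isOpen_iUnion fun n => isOpen_zeroBlock _
  have hG := isGδ_invariantCore hD
  have hd := dense_invariantCore hD dense_iUnion_zeroBlock
  have hpolish : PolishSpace (invariantCore D) := hG.polishSpace
  have hne : Nonempty (invariantCore D) := hd.nonempty.to_subtype
  have hbasis := hasPeriodicBasis_odometerSpace.subAddAction (invariantCore D)
  have hborel : ∀ A : Set (invariantCore D), MeasurableSet[borel _] A → BaireMeasurableSet A :=
    fun A hA => by
      borelize ↥(invariantCore D)
      exact hA.baireMeasurableSet
  refine ⟨invariantCore D, hG, hd, hpolish, inferInstance,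
    fun A hA hinv => hinv.isMeagre_or_isMeagre_compl (hborel A hA),
    not_hasInvariantBorelProbabilityMeasure_of_subset (invariantCore_subset D), ?_,
    hbasis.not_hasWeaklyWanderingPartition fun _ h => h,
    hbasis.not_hasWeaklyWanderingPartition hborel⟩
  rintro ⟨A, hA, hn, hw⟩
  exact hbasis.not_isLocallyWeaklyWandering hA hn hw
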